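/- Let $(c_n)_{n\ge 1}$ be a sequence of points of $\mathbb R^3$ and $(r_n)_{n\ge1}$ a sequence of positive numbers. The closed balls $\overline B(c_n,r_n)$ form a \emph{configuration of balls} if they are pairwise disjoint and $\Omega=\mathbb R^3\setminus\bigcup_{n}\overline B(c_n,r_n)$ is a region (open and connected) containing $0$. The configuration is \emph{separated} if there is $\epsilon>0$ with $|c_n-c_m|\ge 2\epsilon$ for all $n\ne m$, and \emph{avoidable} if, with positive probability, Brownian motion in $\mathbb R^3$ starting from $0$ never hits any of the balls. For integers $m\ge 0$ and $k\ge 1$, a \emph{string} of $2k$ balls is the family of closed balls of radius $1/4$ centred at the points $(m+i,0,0)$, $i=1,\dots,2k$, of the $x_1$-axis. \textbf{Proposition.} There is an avoidable, separated configuration of balls $\overline B(c_n,r_n)$, $n\ge1$, in $\mathbb R^3$ for which $$\sum_{n=1}^\infty \frac{r_n}{|c_n|}=\infty .$$ Moreover, the balls can be taken to be a union of strings: $r_n=1/4$ for all $n$, and there are integers $m_j\ge 0$ and $k_j\ge1$ $(j\ge 0)$ with $m_j+2k_j<m_{j+1}$ such that $$\{c_n : n\ge 1\}=\bigcup_{j\ge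 0}\{(m_j+i,0,0): 1\le i\le 2k_j\}.$$ -/

import Mathlib

open MeasureTheory ProbabilityTheory Filter
open scoped NNReal

universe u

/-- Standard Brownian motion in `ℝᵈ` started at the origin: its coordinates are independent
real Brownian motions (each with almost surely continuous paths). -/
structure IsBrownianMotion {d : ℕ} {Ω : Type u} [MeasurableSpace Ω]
    (W : ℝ≥0 → Ω → EuclideanSpace ℝ (Fin d)) (P : Measure Ω) : Prop where
  coord : ∀ i : Fin d, IsBrownianReal (fun t ω => W t ω i) P
  indep : iIndepFun (fun (i : Fin d) (ω : Ω) (t : ℝ≥0) => W t ω i) P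

/-- The complement in `ℝᵈ` of the union of the closed balls with centres `c n`
and radii `r n`. -/
def complementRegion {d : ℕ} (c : ℕ → EuclideanSpace ℝ (Fin d)) (r : ℕ → ℝ) :
    Set (EuclideanSpace ℝ (Fin d)) :=
  (⋃ n, Metric.closedBall (c n) (r n))ᶜ

/-- A configuration of balls: a sequence of pairwise disjoint (non-degenerate) closed balls
whose complement is a region (open and connected) that contains the origin. -/
structure IsBallConfiguration {d : ℕ} (c : ℕ → EuclideanSpace ℝ (Fin d)) (r : ℕ → ℝ) :
    Prop where
  radius_pos : ∀ n, 0 < r n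
  disjoint : ∀ n m, n ≠ m →
    Disjoint (Metric.closedBall (c n) (r n)) (Metric.closedBall (c m) (r m))
  isOpen_region : IsOpen (complementRegion c r)
  isConnected_region : IsConnected (complementRegion c r)
  zero_mem_region : (0 : EuclideanSpace ℝ (Fin d)) ∈ complementRegion c r

/-- The separation condition on the centres of the balls. -/
def Separated {d : ℕ} (c : ℕ → EuclideanSpace ℝ (Fin d)) : Prop :=
  ∃ ε : ℝ, 0 < ε ∧ ∀ n m, n ≠ m → 2 * ε ≤ dist (c n) (c m)

/-- The balls are avoidable: Brownian motion in `ℝᵈ` started at `0` has a positive probability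
of never hitting any of them. This probability depends only on the law of Brownian motion, so
it is required for every process that is a Brownian motion. -/
def Avoidable {d : ℕ} (c : ℕ → EuclideanSpace ℝ (Fin d)) (r : ℕ → ℝ) : Prop :=
  ∀ (Ω : Type u) [MeasurableSpace Ω] (P : Measure Ω)
    (W : ℝ≥0 → Ω → EuclideanSpace ℝ (Fin d)), IsBrownianMotion W P →
      0 < P {ω | ∀ t : ℝ≥0, ∀ n : ℕ, W t ω ∉ Metric.closedBall (c n) (r n)}

/-- The centres of a string of `2 * k` balls: the points `(m + i, 0, 0)`, `1 ≤ i ≤ 2 * k`,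
of the first coordinate axis of `ℝ³`. -/
def stringCentres (m k : ℕ) : Set (EuclideanSpace ℝ (Fin 3)) :=
  {x | ∃ i : ℕ, 1 ≤ i ∧ i ≤ 2 * k ∧ x = EuclideanSpace.single 0 ((m : ℝ) + (i : ℝ))}

/-! Put `K = 2 ^ 2 ^ (j + 4)` for the `j`-th string: its `2K` centres lie at distances between `K`
and `3K` from the origin. It contributes at least `1/6` to the sum of `r/|c|`, so the sum diverges.
The string is nevertheless hard to hit, since its capacity is only of order `K / log K`.

To exploit this, put charges `2 / 2 ^ (j + 4)`, comparable to `1 / log K`, at the centres. On each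
ball of the string its own charges already give a potential of at least `2 log 2 > 1`
(`one_lt_stringPotential`), while at the origin the total is at most `∑ 2⁻ʲ / 4 = 1/2`. The
potential is excessive, so the maximal inequality `IsBrownianMotion.measure_exists_one_lt_le` bounds
the hitting probability by its value at the origin. -/

/-! ### The Newtonian kernel and Gaussian convolution -/

-- Writes `1 / a` as a mixture of Gaussians, which factor over coordinates. At `a = 0` both sides
-- are `⊤`, so the pole of the kernel is covered.
open Real in
theorem lintegral_exp_neg_mul_sq_div_two {a : ℝ} (ha : 0 ≤ a) :
    ∫⁻ b : ℝ, ENNReal.ofReal (exp (-(b ^ 2 * a ^ 2) / 2)) =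
      ENNReal.ofReal √(2 * π) * (ENNReal.ofReal a)⁻¹ := by
  rcases ha.eq_or_lt with rfl | ha
  · have : ENNReal.ofReal √(2 * π) ≠ 0 := by simp; positivity
    simp only [ne_eq, OfNat.ofNat_ne_zero, not_false_eq_true, zero_pow, mul_zero, neg_zero,
      zero_div, exp_zero, ENNReal.ofReal_one, lintegral_const, one_mul, Real.volume_univ,
      ENNReal.ofReal_zero, ENNReal.inv_zero, ENNReal.mul_top this]
  · have h2 : ∀ b : ℝ, -(b ^ 2 * a ^ 2) / 2 = -(a ^ 2 / 2) * b ^ 2 := fun b => by ring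
    simp_rw [h2]
    rw [← ofReal_integral_eq_lintegral_ofReal (integrable_exp_neg_mul_sq (by positivity))
      (ae_of_all _ fun b => (exp_pos _).le), integral_gaussian, ← ENNReal.ofReal_inv_of_pos ha,
      ← ENNReal.ofReal_mul (by positivity)]
    congr 1
    rw [show π / (a ^ 2 / 2) = (2 * π) / a ^ 2 by field_simp, sqrt_div' _ (by positivity),
      sqrt_sq ha.le, div_eq_mul_inv]

open Real in
theorem lintegral_exp_neg_sq_gaussianReal (b x : ℝ) {h : ℝ≥0} (hh : h ≠ 0) :
    ∫⁻ y, ENNReal.ofReal (exp (-(b ^ 2 * (x + y) ^ 2) / 2)) ∂(gaussianReal 0 h) =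
      ENNReal.ofReal ((√(1 + b ^ 2 * h))⁻¹ * exp (-(b ^ 2 * x ^ 2 / (1 + b ^ 2 * h)) / 2)) := by
  have hp : (0 : ℝ) < h := by exact_mod_cast pos_iff_ne_zero.2 hh
  have hq : (0 : ℝ) < 1 + b ^ 2 * h := by positivity
  rw [gaussianReal_of_var_ne_zero _ hh,
    lintegral_withDensity_eq_lintegral_mul _ (measurable_gaussianPDF _ _) (by fun_prop)]
  have key : ∀ y : ℝ, (gaussianPDF 0 h * fun y => ENNReal.ofReal
      (exp (-(b ^ 2 * (x + y) ^ 2) / 2))) y = ENNReal.ofReal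
      (((√(2 * π * h))⁻¹ * exp (-(b ^ 2 * x ^ 2 / (1 + b ^ 2 * h)) / 2)) *
        exp (-((1 + b ^ 2 * h) / (2 * h)) * (y + b ^ 2 * h * x / (1 + b ^ 2 * h)) ^ 2)) := by
    intro y
    rw [Pi.mul_apply, gaussianPDF, ← ENNReal.ofReal_mul (gaussianPDFReal_nonneg _ _ _),
      gaussianPDFReal, mul_assoc (√(2 * π * h))⁻¹, mul_assoc (√(2 * π * h))⁻¹, ← exp_add,
      ← exp_add]
    congr 3
    field_simp
    ring
  simp_rw [key]
  have hi : Integrable fun y : ℝ =>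
      exp (-((1 + b ^ 2 * h) / (2 * h)) * (y + b ^ 2 * h * x / (1 + b ^ 2 * h)) ^ 2) :=
    (integrable_exp_neg_mul_sq (b := (1 + b ^ 2 * h) / (2 * h)) (by positivity)).comp_add_right
      (b ^ 2 * h * x / (1 + b ^ 2 * h))
  rw [← ofReal_integral_eq_lintegral_ofReal (hi.const_mul _) (ae_of_all _ fun y => by positivity),
    integral_const_mul,
    integral_add_right_eq_self (fun y => exp (-((1 + b ^ 2 * h) / (2 * h)) * y ^ 2)),
    integral_gaussian, show π / ((1 + b ^ 2 * h) / (2 * h)) = (2 * π * h) / (1 + b ^ 2 * h) by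
      field_simp, sqrt_div' _ hq.le]
  congr 1
  have : √(2 * π * h) ≠ 0 := by positivity
  field_simp

/-- The cube is the product of the normalising factors of three Gaussian integrals, so in dimension
3 convolution becomes exactly a change of the mixing variable. -/
theorem hasDerivAt_div_sqrt_one_add_sq_mul {h : ℝ} (hh : 0 ≤ h) (b : ℝ) :
    HasDerivAt (fun b : ℝ => b / √(1 + b ^ 2 * h)) ((√(1 + b ^ 2 * h))⁻¹ ^ 3) b := by
  have hq : (0 : ℝ) < 1 + b ^ 2 * h := by positivity
  have h1 : HasDerivAt (fun b : ℝ => 1 + b ^ 2 * h) (2 * b * h) b := by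
    simpa using ((hasDerivAt_pow 2 b).mul_const h).const_add 1
  have h2 := (hasDerivAt_id b).div (h1.sqrt hq.ne') (Real.sqrt_pos.2 hq).ne'
  refine h2.congr_deriv ?_
  have h3 := Real.sqrt_pos.2 hq
  have h4 := Real.sq_sqrt hq.le
  simp only [id]
  set q := √(1 + b ^ 2 * h)
  field_simp
  nlinarith

/-- The Newtonian kernel of `ℝ³` does not increase under convolution with a centred Gaussian. -/
theorem lintegral_inv_enorm_add_gaussian_le (x : Fin 3 → ℝ) {h : ℝ≥0} (hh : h ≠ 0) :
    ∫⁻ y, ‖WithLp.toLp 2 (x + y)‖ₑ⁻¹ ∂(Measure.pi fun _ : Fin 3 => gaussianReal 0 h) ≤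
      ‖WithLp.toLp 2 x‖ₑ⁻¹ := by
  set C := ENNReal.ofReal √(2 * Real.pi)
  have hC0 : C ≠ 0 := by simp [C]; positivity
  have hC : C ≠ ⊤ := ENNReal.ofReal_ne_top
  have hN : ∀ z : Fin 3 → ℝ, C * ‖WithLp.toLp 2 z‖ₑ⁻¹ =
      ∫⁻ b : ℝ, ∏ i, ENNReal.ofReal (Real.exp (-(b ^ 2 * (z i) ^ 2) / 2)) := by
    intro z
    rw [← ofReal_norm, ← lintegral_exp_neg_mul_sq_div_two (norm_nonneg _)]
    refine lintegral_congr fun b => ?_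
    rw [← ENNReal.ofReal_prod_of_nonneg fun i _ => (Real.exp_pos _).le, ← Real.exp_sum,
      EuclideanSpace.norm_sq_eq, Finset.mul_sum, ← Finset.sum_div, Finset.sum_neg_distrib]
    simp
  rw [← ENNReal.mul_le_mul_iff_right hC0 hC, ← lintegral_const_mul _ (by fun_prop), hN]
  simp_rw [hN]
  rw [lintegral_lintegral_swap (by fun_prop)]
  have hprod : ∀ b : ℝ, ∫⁻ y, ∏ i, ENNReal.ofReal (Real.exp (-(b ^ 2 * ((x + y) i) ^ 2) / 2))
      ∂(Measure.pi fun _ : Fin 3 => gaussianReal 0 h) =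
      ENNReal.ofReal |(√(1 + b ^ 2 * h))⁻¹ ^ 3| *
        ∏ i, ENNReal.ofReal (Real.exp (-((b / √(1 + b ^ 2 * h)) ^ 2 * (x i) ^ 2) / 2)) := by
    intro b
    simp_rw [Pi.add_apply]
    rw [lintegral_prod_eq_prod_lintegral_of_indepFun Finset.univ (fun i (y : Fin 3 → ℝ) =>
      ENNReal.ofReal (Real.exp (-(b ^ 2 * (x i + y i) ^ 2) / 2))) (iIndepFun_pi (X := fun i y =>
      ENNReal.ofReal (Real.exp (-(b ^ 2 * (x i + y) ^ 2) / 2))) fun i => by fun_prop)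
      (fun i => by fun_prop)]
    have heval : ∀ i, ∫⁻ y : Fin 3 → ℝ, ENNReal.ofReal (Real.exp (-(b ^ 2 * (x i + y i) ^ 2) / 2))
        ∂(Measure.pi fun _ : Fin 3 => gaussianReal 0 h) = ∫⁻ y : ℝ,
        ENNReal.ofReal (Real.exp (-(b ^ 2 * (x i + y) ^ 2) / 2)) ∂(gaussianReal 0 h) := fun i =>
      (measurePreserving_eval (fun _ : Fin 3 => gaussianReal 0 h) i).lintegral_comp
        (f := fun y => ENNReal.ofReal (Real.exp (-(b ^ 2 * (x i + y) ^ 2) / 2))) (by fun_prop)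
    simp_rw [heval]
    simp_rw [lintegral_exp_neg_sq_gaussianReal b _ hh]
    have hq : (0 : ℝ) ≤ 1 + b ^ 2 * h := by positivity
    rw [abs_of_nonneg (by positivity), ENNReal.ofReal_pow (by positivity)]
    simp_rw [ENNReal.ofReal_mul (inv_nonneg.2 (Real.sqrt_nonneg (1 + b ^ 2 * (h : ℝ))))]
    rw [Finset.prod_mul_distrib]
    simp only [Finset.prod_const, Finset.card_univ, Fintype.card_fin, div_pow, Real.sq_sqrt hq]
    congr! 6
    ring
  simp_rw [hprod]
  have hinj : Set.InjOn (fun b : ℝ => b / √(1 + b ^ 2 * h)) Set.univ := by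
    refine (strictMono_of_hasDerivAt_pos (fun b => hasDerivAt_div_sqrt_one_add_sq_mul h.2 b)
      fun b => ?_).injective.injOn
    have : (0 : ℝ) < 1 + b ^ 2 * h := by positivity
    positivity
  have hcv := lintegral_image_eq_lintegral_abs_deriv_mul MeasurableSet.univ
    (fun b _ => (hasDerivAt_div_sqrt_one_add_sq_mul h.2 b).hasDerivWithinAt) hinj
    (fun b => ∏ i, ENNReal.ofReal (Real.exp (-(b ^ 2 * (x i) ^ 2) / 2)))
  rw [setLIntegral_univ] at hcv
  -- The substitution only reaches `|b| < 1 / √h`; discarding the rest of the line gives the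
  -- inequality.
  exact hcv ▸ setLIntegral_le_lintegral _ _

/-! ### Maximal inequality for random walks -/

/-- Extension by zero of a finite sequence. -/
def extendZero {X : Type*} [Zero X] {N : ℕ} (y : Fin N → X) (l : ℕ) : X :=
  if h : l < N then y ⟨l, h⟩ else 0

theorem measurable_extendZero {X : Type*} [Zero X] [MeasurableSpace X] {N : ℕ} (l : ℕ) :
    Measurable fun y : Fin N → X => extendZero y l := by
  unfold extendZero
  split_ifs with h
  · exact measurable_pi_apply _
  · exact measurable_const

/-- Discrete maximal inequality for excessive functions of a random walk. -/
theorem pi_exists_one_le_excessive_le {X : Type*} [AddCommGroup X] [MeasurableSpace X]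
    [MeasurableAdd₂ X] (μ : Measure X) [IsProbabilityMeasure μ] {f : X → ENNReal}
    (hf : Measurable f) (hexc : ∀ x, ∫⁻ y, f (x + y) ∂μ ≤ f x) (N : ℕ) (x : X) :
    (Measure.pi fun _ : Fin N => μ)
      {y | ∃ j ≤ N, 1 ≤ f (x + ∑ l ∈ Finset.range j, extendZero y l)} ≤ f x := by
  induction N generalizing x with
  | zero =>
    by_cases h : 1 ≤ f x
    · exact prob_le_one.trans h
    · simp [h]
  | succ N ih =>
    by_cases h : 1 ≤ f x
    · exact prob_le_one.trans h
    have hm : ∀ (N : ℕ), MeasurableSet {p : X × (Fin N → X) | ∃ j ≤ N,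
        1 ≤ f (x + p.1 + ∑ l ∈ Finset.range j, extendZero p.2 l)} := by
      intro N
      have : {p : X × (Fin N → X) | ∃ j ≤ N,
          1 ≤ f (x + p.1 + ∑ l ∈ Finset.range j, extendZero p.2 l)} = ⋃ j ∈ Set.Iic N,
          {p | 1 ≤ f (x + p.1 + ∑ l ∈ Finset.range j, extendZero p.2 l)} := by
        ext p; simp
      rw [this]
      refine MeasurableSet.biUnion (Set.to_countable _) fun j _ =>
        measurableSet_le measurable_const (hf.comp ?_)
      refine (measurable_fst.const_add x).add (Finset.measurable_fun_sum _ fun l _ =>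
        (measurable_extendZero l).comp measurable_snd)
    have hset : {y : Fin (N + 1) → X | ∃ j ≤ N + 1,
        1 ≤ f (x + ∑ l ∈ Finset.range j, extendZero y l)} =
        (MeasurableEquiv.piFinSuccAbove (fun _ => X) 0) ⁻¹' {p : X × (Fin N → X) | ∃ j ≤ N,
          1 ≤ f (x + p.1 + ∑ l ∈ Finset.range j, extendZero p.2 l)} := by
      ext y
      have hy : ∀ j, x + ∑ l ∈ Finset.range (j + 1), extendZero y l =
          x + y 0 + ∑ l ∈ Finset.range j, extendZero (fun i : Fin N => y i.succ) l := by
        intro j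
        rw [Finset.sum_range_succ', add_comm _ (extendZero y 0), ← add_assoc]
        congr 1
        · simp [extendZero]
      constructor
      · rintro ⟨j, hj, h1⟩
        rcases j with _ | j
        · simp [h] at h1
        · exact ⟨j, by omega, by rw [hy] at h1; exact h1⟩
      · rintro ⟨j, hj, h1⟩
        exact ⟨j + 1, by omega, by rw [hy]; exact h1⟩
    -- Condition on the first increment `y`: induction bounds the conditional probability by `f (x +
    -- y)`, and excessivity integrates this to at most `f x`.
    rw [hset, (measurePreserving_piFinSuccAbove (fun _ : Fin (N + 1) => μ) 0).measure_preimage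
      (hm N).nullMeasurableSet, Measure.prod_apply (hm N)]
    exact (lintegral_mono fun y => ih (x + y)).trans (hexc x)

/-- Independence gives the increments coordinate by coordinate; the random walk needs them time by
time. -/
theorem pi_pi_map_swap {ι κ X : Type*} [Fintype ι] [Fintype κ] [MeasurableSpace X]
    (μ : Measure X) [IsProbabilityMeasure μ] :
    (Measure.pi fun _ : ι => Measure.pi fun _ : κ => μ).map Function.swap =
      Measure.pi fun _ : κ => Measure.pi fun _ : ι => μ := by
  simp_rw [← Measure.infinitePi_eq_pi]
  rw [← Measure.infinitePi_map_curry (fun (_ : ι) (_ : κ) => μ),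
    ← Measure.infinitePi_map_curry (fun (_ : κ) (_ : ι) => μ),
    ← Measure.map_infinitePi_infinitePi_of_inj (P := fun _ : ι × κ => μ)
      (f := (Prod.swap : κ × ι → ι × κ)) Prod.swap_injective,
    Measure.map_map (by fun_prop) (by fun_prop), Measure.map_map (by fun_prop) (by fun_prop)]
  rfl

/-! ### Maximal inequality for Brownian motion -/

section Brownian

variable {d : ℕ} {Ω : Type u} [MeasurableSpace Ω]
  {W : ℝ≥0 → Ω → EuclideanSpace ℝ (Fin d)} {P : Measure Ω}

theorem IsBrownianMotion.hasLaw_increments (hW : IsBrownianMotion W P) (h : ℝ≥0) (N : ℕ) :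
    HasLaw (fun ω (j : Fin N) (i : Fin d) => W ((j + 1 : ℕ) * h) ω i - W ((j : ℕ) * h) ω i)
      (Measure.pi fun _ : Fin N => Measure.pi fun _ : Fin d => gaussianReal 0 h) P := by
  have hmono : Monotone fun j : ℕ => (j : ℝ≥0) * h := fun a b hab => by
    dsimp only; gcongr
  have hlaw1 : ∀ (i : Fin d) (j : ℕ),
      HasLaw (fun ω => W ((j + 1 : ℕ) * h) ω i - W (j * h) ω i) (gaussianReal 0 h) P := by
    intro i j
    have := (hW.coord i).hasLaw_sub ((j + 1 : ℕ) * h) (j * h)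
    have e : nndist ((j + 1 : ℕ) * h : ℝ≥0).1 (j * h : ℝ≥0).1 = h := by
      apply NNReal.eq
      rw [coe_nndist, Real.dist_eq]
      simp only [NNReal.val_eq_coe]
      push_cast
      rw [show ((j : ℝ) + 1) * h - j * h = h by ring, abs_of_nonneg h.coe_nonneg]
    rw [e] at this
    exact this
  have hlaw2 : ∀ i : Fin d, HasLaw (fun ω (j : Fin N) =>
      W ((j + 1 : ℕ) * h) ω i - W ((j : ℕ) * h) ω i)
      (Measure.pi fun _ : Fin N => gaussianReal 0 h) P := by
    intro i
    have hm : ∀ j : Fin N, AEMeasurable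
        (fun ω => W ((j + 1 : ℕ) * h) ω i - W ((j : ℕ) * h) ω i) P :=
      fun j => (hlaw1 i j).aemeasurable
    refine ⟨aemeasurable_pi_iff.2 hm, ?_⟩
    have hind := ((hW.coord i).hasIndepIncrements.nat hmono).precomp
      (g := fun j : Fin N => (j : ℕ)) Fin.val_injective
    exact (hind.map_fun_eq_pi_map hm).trans (by congr 1; ext1 j; exact (hlaw1 i j).map_eq)
  have hlaw3 : HasLaw (fun ω (i : Fin d) (j : Fin N) =>
      W ((j + 1 : ℕ) * h) ω i - W ((j : ℕ) * h) ω i)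
      (Measure.pi fun _ : Fin d => Measure.pi fun _ : Fin N => gaussianReal 0 h) P := by
    have hm := fun i => (hlaw2 i).aemeasurable
    refine ⟨aemeasurable_pi_iff.2 hm, ?_⟩
    have hind := hW.indep.comp
      (fun _ (w : ℝ≥0 → ℝ) (j : Fin N) => w ((j + 1 : ℕ) * h) - w ((j : ℕ) * h))
      (fun _ => by fun_prop)
    exact (hind.map_fun_eq_pi_map hm).trans (by congr 1; ext1 i; exact (hlaw2 i).map_eq)
  have hswap : Measurable (Function.swap : (Fin d → Fin N → ℝ) → Fin N → Fin d → ℝ) :=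
    measurable_pi_lambda _ fun k => measurable_pi_lambda _ fun i => by
      simp only [Function.swap]; fun_prop
  refine ⟨hswap.comp_aemeasurable hlaw3.aemeasurable, ?_⟩
  rw [← pi_pi_map_swap, ← hlaw3.map_eq,
    AEMeasurable.map_map_of_aemeasurable hswap.aemeasurable hlaw3.aemeasurable]
  rfl

theorem IsBrownianMotion.isProbabilityMeasure (hW : IsBrownianMotion W P) :
    IsProbabilityMeasure P :=
  hW.indep.isProbabilityMeasure

theorem IsBrownianMotion.ae_zero_eq_zero (hW : IsBrownianMotion W P) : ∀ᵐ ω ∂P, W 0 ω = 0 := by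
  filter_upwards [ae_all_iff.2 fun i => (hW.coord i).eval_zero_ae_eq_zero] with ω hω
  ext i
  exact hω i

theorem IsBrownianMotion.ae_continuous (hW : IsBrownianMotion W P) :
    ∀ᵐ ω ∂P, Continuous fun t => W t ω := by
  filter_upwards [ae_all_iff.2 fun i => (hW.coord i).cont] with ω hω
  exact (PiLp.continuous_toLp 2 _).comp (continuous_pi hω)

/-- `f` does not increase under convolution with centred isotropic Gaussian measures. -/
def GaussianExcessive (f : EuclideanSpace ℝ (Fin d) → ENNReal) : Prop :=
  ∀ (h : ℝ≥0), h ≠ 0 → ∀ x : Fin d → ℝ,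
    ∫⁻ y, f (WithLp.toLp 2 (x + y)) ∂(Measure.pi fun _ : Fin d => gaussianReal 0 h) ≤
      f (WithLp.toLp 2 x)

theorem IsBrownianMotion.measure_exists_grid_le (hW : IsBrownianMotion W P)
    {f : EuclideanSpace ℝ (Fin d) → ENNReal} (hf : Measurable f) (hexc : GaussianExcessive f)
    {h : ℝ≥0} (hh : h ≠ 0) (N : ℕ) :
    P {ω | ∃ j ≤ N, 1 ≤ f (W ((j : ℕ) * h) ω)} ≤ f 0 := by
  have hg : Measurable fun x : Fin d → ℝ => f (WithLp.toLp 2 x) := by fun_prop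
  have hmax := pi_exists_one_le_excessive_le (Measure.pi fun _ : Fin d => gaussianReal 0 h) hg
    (hexc h hh) N 0
  rw [← (hW.hasLaw_increments h N).map_eq] at hmax
  refine le_trans ?_ (((Measure.le_map_apply (hW.hasLaw_increments h N).aemeasurable _).trans
    hmax).trans (by simp))
  refine measure_mono_ae ?_
  filter_upwards [hW.ae_zero_eq_zero] with ω h0
  rintro ⟨j, hj, h1⟩
  refine ⟨j, hj, ?_⟩
  have : ∀ l ∈ Finset.range j, extendZero (fun (j : Fin N) (i : Fin d) =>
      W ((j + 1 : ℕ) * h) ω i - W ((j : ℕ) * h) ω i) l =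
      (fun l : ℕ => (W (l * h) ω).ofLp) (l + 1) - (fun l : ℕ => (W (l * h) ω).ofLp) l := by
    intro l hl
    have hl' : l < N := (Finset.mem_range.1 hl).trans_le hj
    ext i
    simp [extendZero, hl']
  have hsum := (Finset.sum_congr rfl this).trans
    (Finset.sum_range_sub (fun l : ℕ => (W (l * h) ω).ofLp) j)
  rw [zero_add, hsum]
  simpa [h0] using h1

/-- Maximal inequality for Brownian motion and lower semicontinuous excessive functions. -/
theorem IsBrownianMotion.measure_exists_one_lt_le (hW : IsBrownianMotion W P)
    {f : EuclideanSpace ℝ (Fin d) → ENNReal} (hf : LowerSemicontinuous f)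
    (hexc : GaussianExcessive f) :
    P {ω | ∃ t, 1 < f (W t ω)} ≤ f 0 := by
  -- Dyadic grid of mesh `2⁻ⁿ` up to time `n`; the grids are nested via `j ↦ 2 * j`.
  let A : ℕ → Set Ω := fun n => {ω | ∃ j ≤ n * 2 ^ n, 1 ≤ f (W ((j : ℕ) * (1 / 2 ^ n)) ω)}
  have hA : Monotone A := by
    refine monotone_nat_of_le_succ fun n => ?_
    rintro ω ⟨j, hj, h1⟩
    refine ⟨2 * j, ?_, ?_⟩
    · calc 2 * j ≤ 2 * (n * 2 ^ n) := by gcongr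
        _ = n * 2 ^ (n + 1) := by ring
        _ ≤ (n + 1) * 2 ^ (n + 1) := by gcongr; omega
    · convert h1 using 3
      push_cast
      field_simp
      ring
  have hle : P {ω | ∃ t, 1 < f (W t ω)} ≤ P (⋃ n, A n) := by
    refine measure_mono_ae ?_
    filter_upwards [hW.ae_continuous] with ω hc
    rintro ⟨t, ht⟩
    have hlim : Tendsto (fun n : ℕ => (⌊(t : ℝ) * 2 ^ n⌋₊ : ℝ≥0) * (1 / 2 ^ n)) atTop (nhds t) := by
      have h3 : Tendsto (fun n : ℕ => (2 : ℝ) ^ n) atTop atTop :=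
        tendsto_pow_atTop_atTop_of_one_lt (by norm_num)
      rw [← NNReal.tendsto_coe]
      convert (tendsto_nat_floor_mul_div_atTop (R := ℝ) t.coe_nonneg).comp h3 using 2 with n
      simp only [Function.comp, div_eq_mul_inv, one_mul]
      push_cast
      rfl
    -- Lower semicontinuity and the strict inequality make this set of times open, so dyadic times
    -- near `t` detect it.
    have hopen : IsOpen {t | 1 < f (W t ω)} := (hf.isOpen_preimage 1).preimage hc
    obtain ⟨n, hn, hnt⟩ := ((hlim.eventually (hopen.mem_nhds ht)).and
      (tendsto_natCast_atTop_atTop.eventually_ge_atTop t)).exists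
    refine Set.mem_iUnion.2 ⟨n, ⌊(t : ℝ) * 2 ^ n⌋₊, ?_, hn.le⟩
    refine Nat.floor_le_of_le ?_
    push_cast
    gcongr
    exact_mod_cast hnt
  refine hle.trans ?_
  rw [hA.measure_iUnion]
  exact iSup_le fun n => hW.measure_exists_grid_le hf.measurable hexc (by positivity) _

end Brownian

/-! ### Topology of the complement -/

section Region

variable {c : ℕ → EuclideanSpace ℝ (Fin 3)}

theorem complementRegion_mem_iff {d : ℕ} {c : ℕ → EuclideanSpace ℝ (Fin d)} {r : ℕ → ℝ}
    {x : EuclideanSpace ℝ (Fin d)} :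
    x ∈ complementRegion c r ↔ ∀ n, r n < dist x (c n) := by
  simp [complementRegion]

theorem isPreconnected_coord_gt (a : ℝ) (i : Fin 3) :
    IsPreconnected {x : EuclideanSpace ℝ (Fin 3) | a < x i} :=
  (convex_halfSpace_gt (EuclideanSpace.proj (𝕜 := ℝ) i).toLinearMap.isLinear a).isPreconnected

theorem isPreconnected_coord_lt (a : ℝ) (i : Fin 3) :
    IsPreconnected {x : EuclideanSpace ℝ (Fin 3) | x i < a} :=
  (convex_halfSpace_lt (EuclideanSpace.proj (𝕜 := ℝ) i).toLinearMap.isLinear a).isPreconnected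

/-- The complement of balls of radius `ρ` centred on the first coordinate axis is connected. -/
theorem isPreconnected_complementRegion_of_axis (hc1 : ∀ n, c n 1 = 0) (hc2 : ∀ n, c n 2 = 0)
    {ρ : ℝ} (hρ : 0 < ρ) : IsPreconnected (complementRegion c fun _ => ρ) := by
  have hcoord : ∀ (i : Fin 3) (x : EuclideanSpace ℝ (Fin 3)), (∀ n, c n i = 0) → ρ < |x i| →
      x ∈ complementRegion c fun _ => ρ := by
    intro i x hi hx
    refine complementRegion_mem_iff.2 fun n => hx.trans_le ?_
    have := PiLp.norm_apply_le (x - c n) i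
    rwa [PiLp.sub_apply, hi, sub_zero, Real.norm_eq_abs, ← dist_eq_norm] at this
  -- Three half-spaces missing all balls, consecutive ones overlapping: a connected path around the
  -- axis.
  set H : Set (EuclideanSpace ℝ (Fin 3)) := {x | ρ < x 1} ∪ ({x | ρ < x 2} ∪ {x | x 1 < -ρ})
  have hH : IsPreconnected H := by
    refine (isPreconnected_coord_gt ρ 1).union (!₂[0, 2 * ρ, 2 * ρ]) ?_ ?_
      ((isPreconnected_coord_gt ρ 2).union (!₂[0, -(2 * ρ), 2 * ρ]) ?_ ?_
        (isPreconnected_coord_lt (-ρ) 1))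
    · simp [hρ]
    · simp [hρ]
    · simp [hρ]
    · simp [hρ]
  have hHsub : H ⊆ complementRegion c fun _ => ρ := by
    rintro x (hx | hx | hx)
    · exact hcoord 1 x hc1 (hx.trans_le (le_abs_self _))
    · exact hcoord 2 x hc2 (hx.trans_le (le_abs_self _))
    · exact hcoord 1 x hc1 (lt_of_lt_of_le (by simp only [Set.mem_ofPred_eq] at hx; linarith)
        (neg_le_abs _))
  -- Moving away from the plane `x 1 = 0` decreases no distance to a centre, so every point can be
  -- pushed into `H`.
  have hmove : ∀ x ∈ complementRegion c (fun _ => ρ), ∀ v : ℝ, 0 ≤ x 1 * v →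
      x + EuclideanSpace.single 1 v ∈ complementRegion c fun _ => ρ := by
    intro x hx v hv
    refine complementRegion_mem_iff.2 fun n => (complementRegion_mem_iff.1 hx n).trans_le ?_
    rw [EuclideanSpace.dist_eq, EuclideanSpace.dist_eq]
    refine Real.sqrt_le_sqrt ?_
    simp only [Fin.sum_univ_three, Real.dist_eq, sq_abs, PiLp.add_apply, hc1, hc2]
    simp
    nlinarith [sq_nonneg v]
  refine isPreconnected_of_forall (!₂[0, 2 * ρ, 0]) fun x hx => ?_
  obtain ⟨v, hv, hxv⟩ : ∃ v, 0 ≤ x 1 * v ∧ x + EuclideanSpace.single 1 v ∈ H := by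
    rcases le_total 0 (x 1) with h | h
    · exact ⟨2 * ρ, by positivity, Or.inl (by simp; linarith)⟩
    · exact ⟨-(2 * ρ), by nlinarith, Or.inr (Or.inr (by simp; linarith))⟩
  refine ⟨segment ℝ x (x + EuclideanSpace.single 1 v) ∪ H, Set.union_subset ?_ hHsub,
    Or.inr (Or.inl (by simp [hρ])), Or.inl (left_mem_segment _ _ _),
    (convex_segment _ _).isPreconnected.union _ (right_mem_segment _ _ _) hxv hH⟩
  rw [segment_eq_image']
  rintro _ ⟨t, ht, rfl⟩
  have := hmove x hx (t * v) (by nlinarith [mul_nonneg ht.1 hv])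
  convert this using 2
  ext i
  simp only [add_sub_cancel_left, PiLp.smul_apply, smul_eq_mul]
  by_cases h : i = 1 <;> simp [h]

/-- Separation makes the set of centres closed, and the union of the balls is then its closed
thickening. -/
theorem isOpen_complementRegion_of_separated {d : ℕ} {c : ℕ → EuclideanSpace ℝ (Fin d)} {ρ : ℝ}
    (hρ : 0 ≤ ρ) (hc : Separated c) : IsOpen (complementRegion c fun _ => ρ) := by
  obtain ⟨ε, hε, hsep⟩ := hc
  have hcl : IsClosed (Set.range c) := by
    refine Metric.isClosed_of_pairwise_le_dist (ε := 2 * ε) (by positivity) ?_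
    rintro _ ⟨n, rfl⟩ _ ⟨m, rfl⟩ hnm
    exact hsep n m fun h => hnm (h ▸ rfl)
  have : (⋃ n, Metric.closedBall (c n) ρ) = Metric.cthickening ρ (Set.range c) := by
    rw [hcl.cthickening_eq_biUnion_closedBall hρ, Set.biUnion_range]
  rw [complementRegion, this]
  exact Metric.isClosed_cthickening.isOpen_compl

end Region

/-! ### The strings and the divergent sum -/

/-- The point `(s, 0, 0)`. -/
noncomputable def axisPoint (s : ℕ) : EuclideanSpace ℝ (Fin 3) :=
  EuclideanSpace.single 0 (s : ℝ)

theorem dist_axisPoint (s t : ℕ) : dist (axisPoint s) (axisPoint t) = |(s : ℝ) - t| := by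
  rw [axisPoint, axisPoint, PiLp.dist_single_same, Real.dist_eq]

theorem norm_axisPoint (s : ℕ) : ‖axisPoint s‖ = s := by
  simp [axisPoint]

/-- The offset `m_j`, and also half the length `k_j`, of the `j`-th string. -/
def stringOffset (j : ℕ) : ℕ := 2 ^ 2 ^ (j + 4)

theorem stringOffset_pos (j : ℕ) : 0 < stringOffset j := by unfold stringOffset; positivity

theorem four_mul_stringOffset_lt (j : ℕ) : 4 * stringOffset j < stringOffset (j + 1) := by
  have h : stringOffset (j + 1) = stringOffset j * stringOffset j := by
    simp only [stringOffset, ← pow_add]; congr 1; ring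
  have h2 : 4 < stringOffset j := by
    have : 3 ≤ 2 ^ (j + 4) := by
      have := Nat.lt_two_pow_self (n := j + 4); omega
    calc 4 < 2 ^ 3 := by norm_num
      _ ≤ _ := Nat.pow_le_pow_right (by norm_num) this
  rw [h]
  have := stringOffset_pos j
  gcongr

theorem lt_stringOffset (j : ℕ) : j < stringOffset j := by
  induction j with
  | zero => exact stringOffset_pos 0
  | succ j ih => have := four_mul_stringOffset_lt j; omega

/-- `(s, 0, 0)` is the centre of a ball of one of the strings. -/
def IsStringIndex (s : ℕ) : Prop := ∃ j, s ∈ Finset.Ioc (stringOffset j) (3 * stringOffset j)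

theorem IsStringIndex.one_le {s : ℕ} (hs : IsStringIndex s) : 1 ≤ s := by
  obtain ⟨j, hj⟩ := hs
  have := (Finset.mem_Ioc.1 hj).1
  omega

theorem infinite_setOf_isStringIndex : {s | IsStringIndex s}.Infinite := by
  refine Set.infinite_of_forall_exists_gt fun n => ⟨3 * stringOffset n, ⟨n, ?_⟩, ?_⟩
  · have := stringOffset_pos n
    simp only [Finset.mem_Ioc]; omega
  · have := lt_stringOffset n; omega

/-- The centres of all strings, in increasing order. -/
noncomputable def centre (n : ℕ) : EuclideanSpace ℝ (Fin 3) := axisPoint (Nat.nth IsStringIndex n)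

theorem isStringIndex_nth (n : ℕ) : IsStringIndex (Nat.nth IsStringIndex n) :=
  Nat.nth_mem_of_infinite infinite_setOf_isStringIndex n

theorem one_le_dist_centre {n m : ℕ} (h : n ≠ m) : 1 ≤ dist (centre n) (centre m) := by
  have hne : Nat.nth IsStringIndex n ≠ Nat.nth IsStringIndex m :=
    (Nat.nth_injective infinite_setOf_isStringIndex).ne h
  rw [centre, centre, dist_axisPoint]
  have : (1 : ℤ) ≤ |(Nat.nth IsStringIndex n : ℤ) - Nat.nth IsStringIndex m| :=
    Int.one_le_abs (by omega)
  exact_mod_cast this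

theorem separated_centre : Separated centre :=
  ⟨1 / 2, by norm_num, fun n m h => by simpa using one_le_dist_centre h⟩

theorem isBallConfiguration_centre : IsBallConfiguration centre fun _ => 1 / 4 where
  radius_pos _ := by norm_num
  disjoint n m h := Metric.closedBall_disjoint_closedBall (by
    have := one_le_dist_centre h; linarith)
  isOpen_region := isOpen_complementRegion_of_separated (by norm_num) separated_centre
  isConnected_region := by
    refine ⟨⟨EuclideanSpace.single 1 1, complementRegion_mem_iff.2 fun n => ?_⟩,
      isPreconnected_complementRegion_of_axis (fun n => by simp [centre, axisPoint])
        (fun n => by simp [centre, axisPoint]) (by norm_num)⟩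
    have := PiLp.norm_apply_le (EuclideanSpace.single 1 1 - centre n) 1
    rw [← dist_eq_norm] at this
    refine lt_of_lt_of_le ?_ this
    simp [centre, axisPoint]
    norm_num
  zero_mem_region := by
    refine complementRegion_mem_iff.2 fun n => ?_
    rw [dist_zero_left, centre, norm_axisPoint]
    have : (1 : ℝ) ≤ Nat.nth IsStringIndex n := by exact_mod_cast (isStringIndex_nth n).one_le
    linarith

theorem range_centre :
    Set.range centre = ⋃ j, stringCentres (stringOffset j) (stringOffset j) := by
  have : centre = axisPoint ∘ Nat.nth IsStringIndex := rfl
  rw [this, Set.range_comp, Nat.range_nth_of_infinite infinite_setOf_isStringIndex]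
  ext x
  simp only [Set.mem_image, Set.mem_ofPred_eq, Set.mem_iUnion, stringCentres, IsStringIndex,
    Finset.mem_Ioc]
  constructor
  · rintro ⟨s, ⟨j, h1, h2⟩, rfl⟩
    refine ⟨j, s - stringOffset j, by omega, by omega, ?_⟩
    rw [axisPoint, Nat.cast_sub h1.le, add_sub_cancel]
  · rintro ⟨j, i, h1, h2, rfl⟩
    exact ⟨stringOffset j + i, ⟨j, by omega, by omega⟩, by rw [axisPoint]; push_cast; rfl⟩

theorem tendsto_sum_radius_div_norm_centre :
    Tendsto (fun N : ℕ => ∑ n ∈ Finset.range N, (1 / 4 : ℝ) / ‖centre n‖) atTop atTop := by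
  classical
  rw [← not_summable_iff_tendsto_nat_atTop_of_nonneg fun n => by positivity]
  intro hsum
  let g : ℕ → ℝ := fun s => if IsStringIndex s then (1 / 4 : ℝ) / s else 0
  have hg : Summable g := by
    rw [← (Nat.nth_injective infinite_setOf_isStringIndex).summable_iff]
    · convert hsum using 2 with n
      simp [g, centre, norm_axisPoint, isStringIndex_nth]
    · intro s hs
      rw [Nat.range_nth_of_infinite infinite_setOf_isStringIndex] at hs
      exact if_neg hs
  -- Cauchy criterion: a string beyond `s` has `2K` terms, each at least `1 / (12K)`, hence sum at
  -- least `1/6`.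
  obtain ⟨s, hs⟩ := summable_iff_vanishing_norm.1 hg (1 / 6) (by norm_num)
  obtain ⟨j, hj⟩ := s.bddAbove
  have hdisj : Disjoint (Finset.Ioc (stringOffset j) (3 * stringOffset j)) s := by
    refine Finset.disjoint_left.2 fun a ha has => ?_
    have h1 := hj has
    have h2 := (Finset.mem_Ioc.1 ha).1
    have := lt_stringOffset j
    omega
  refine (hs _ hdisj).not_ge ((le_abs_self _).trans' ?_)
  have hpos : (0 : ℝ) < stringOffset j := by exact_mod_cast stringOffset_pos j
  calc (1 / 6 : ℝ) = ∑ a ∈ Finset.Ioc (stringOffset j) (3 * stringOffset j),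
        (1 / 4 : ℝ) / (3 * stringOffset j) := by
        rw [Finset.sum_const, Nat.card_Ioc, nsmul_eq_mul,
          show 3 * stringOffset j - stringOffset j = 2 * stringOffset j by omega]
        push_cast
        field_simp
        norm_num
    _ ≤ _ := by
        refine Finset.sum_le_sum fun a ha => ?_
        simp only [g, if_pos (show IsStringIndex a from ⟨j, ha⟩)]
        have h1 := Finset.mem_Ioc.1 ha
        have : (0 : ℝ) < a := by exact_mod_cast (by omega : 0 < a)
        have : (a : ℝ) ≤ 3 * stringOffset j := by exact_mod_cast h1.2
        gcongr

/-! ### The potential of the strings -/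

/-- A sum of Newtonian potentials of unit charges at the centres, weighted string by string. -/
noncomputable def stringPotential (x : EuclideanSpace ℝ (Fin 3)) : ENNReal :=
  ∑' j, ENNReal.ofReal (2 / 2 ^ (j + 4)) *
    ∑ s ∈ Finset.Ioc (stringOffset j) (3 * stringOffset j), ‖x - axisPoint s‖ₑ⁻¹

theorem lowerSemicontinuous_stringPotential : LowerSemicontinuous stringPotential := by
  refine lowerSemicontinuous_tsum fun j => Continuous.lowerSemicontinuous ?_
  refine (ENNReal.continuous_const_mul ENNReal.ofReal_ne_top).comp ?_
  fun_prop

theorem gaussianExcessive_stringPotential : GaussianExcessive stringPotential := by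
  intro h hh x
  unfold stringPotential
  rw [lintegral_tsum fun j => by fun_prop]
  gcongr with j
  rw [lintegral_const_mul _ (by fun_prop), lintegral_finsetSum _ fun s _ => by fun_prop]
  gcongr with s
  have := lintegral_inv_enorm_add_gaussian_le (x - (axisPoint s).ofLp) hh
  simp_rw [sub_add_eq_add_sub] at this
  exact this

theorem stringPotential_zero_lt_one : stringPotential 0 < 1 := by
  have hterm : ∀ j, ENNReal.ofReal (2 / 2 ^ (j + 4)) *
      ∑ s ∈ Finset.Ioc (stringOffset j) (3 * stringOffset j), ‖0 - axisPoint s‖ₑ⁻¹ ≤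
      ENNReal.ofReal (1 / 4 * (1 / 2) ^ j) := by
    intro j
    have hpos : (0 : ℝ) < stringOffset j := by exact_mod_cast stringOffset_pos j
    have hs : ∀ s ∈ Finset.Ioc (stringOffset j) (3 * stringOffset j), ‖0 - axisPoint s‖ₑ⁻¹ ≤
        ENNReal.ofReal (1 / stringOffset j) := by
      intro s hs
      rw [one_div, ENNReal.ofReal_inv_of_pos hpos, zero_sub, enorm_neg, ← ofReal_norm,
        norm_axisPoint]
      gcongr
      exact_mod_cast (Finset.mem_Ioc.1 hs).1.le
    calc _ ≤ ENNReal.ofReal (2 / 2 ^ (j + 4)) *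
          ∑ s ∈ Finset.Ioc (stringOffset j) (3 * stringOffset j),
            ENNReal.ofReal (1 / stringOffset j) := by gcongr with s hs'; exact hs s hs'
      _ = _ := by
        rw [← ENNReal.ofReal_sum_of_nonneg fun _ _ => by positivity,
          ← ENNReal.ofReal_mul (by positivity), Finset.sum_const, Nat.card_Ioc, nsmul_eq_mul,
          show 3 * stringOffset j - stringOffset j = 2 * stringOffset j by omega]
        congr 1
        push_cast
        rw [one_div_pow, pow_add]
        field_simp
        norm_num
  have hsum : HasSum (fun j : ℕ => (1 / 4 : ℝ) * (1 / 2) ^ j) (1 / 4 * 2) :=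
    hasSum_geometric_two.mul_left _
  calc stringPotential 0 ≤ ∑' j : ℕ, ENNReal.ofReal (1 / 4 * (1 / 2) ^ j) :=
        ENNReal.tsum_le_tsum hterm
    _ = ENNReal.ofReal (1 / 4 * 2) := by
        rw [← ENNReal.ofReal_tsum_of_nonneg (fun j => by positivity) hsum.summable, hsum.tsum_eq]
    _ < 1 := by rw [ENNReal.ofReal_lt_one]; norm_num

/-- On at least one side of `s` the string has centres at distances `0, …, K - 1` from `s`; since
`x` is within `1/4` of `s`, they are at distance at most `i + 1` from `x`. -/
theorem ofReal_harmonic_le_sum_inv_enorm {K s : ℕ} (hs : s ∈ Finset.Ioc K (3 * K))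
    {x : EuclideanSpace ℝ (Fin 3)} (hx : dist x (axisPoint s) ≤ 1 / 4) :
    ENNReal.ofReal (harmonic K : ℝ) ≤ ∑ t ∈ Finset.Ioc K (3 * K), ‖x - axisPoint t‖ₑ⁻¹ := by
  rw [Finset.mem_Ioc] at hs
  obtain ⟨g, hinj, hmem, hdist⟩ : ∃ g : ℕ → ℕ, Set.InjOn g (Finset.range K) ∧
      (∀ i ∈ Finset.range K, g i ∈ Finset.Ioc K (3 * K)) ∧
      ∀ i ∈ Finset.range K, |(s : ℝ) - g i| = i := by
    by_cases h : s ≤ 2 * K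
    · refine ⟨fun i => s + i, fun a _ b _ hab => by simpa using hab, fun i hi => ?_, fun i _ => ?_⟩
      · simp only [Finset.mem_range, Finset.mem_Ioc] at hi ⊢; omega
      · simp
    · refine ⟨fun i => s - i, fun a ha b hb hab => ?_, fun i hi => ?_, fun i hi => ?_⟩
      · simp only [Finset.coe_range, Set.mem_Iio] at ha hb hab; omega
      · simp only [Finset.mem_range, Finset.mem_Ioc] at hi ⊢; omega
      · simp only [Finset.mem_range] at hi
        rw [Nat.cast_sub (by omega)]
        simp
  calc ENNReal.ofReal (harmonic K : ℝ)
      = ∑ i ∈ Finset.range K, ENNReal.ofReal (((i + 1 : ℕ) : ℝ)⁻¹) := by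
        rw [← ENNReal.ofReal_sum_of_nonneg fun _ _ => by positivity, harmonic]
        push_cast
        rfl
    _ ≤ ∑ i ∈ Finset.range K, ‖x - axisPoint (g i)‖ₑ⁻¹ := by
        refine Finset.sum_le_sum fun i hi => ?_
        rw [ENNReal.ofReal_inv_of_pos (by positivity), ← ofReal_norm, ← dist_eq_norm]
        gcongr
        have := dist_triangle x (axisPoint s) (axisPoint (g i))
        rw [dist_axisPoint s (g i), hdist i hi] at this
        push_cast
        linarith
    _ = ∑ t ∈ (Finset.range K).image g, ‖x - axisPoint t‖ₑ⁻¹ :=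
        (Finset.sum_image (f := fun t => ‖x - axisPoint t‖ₑ⁻¹) hinj).symm
    _ ≤ _ := Finset.sum_le_sum_of_subset (Finset.image_subset_iff.2 hmem)

theorem one_lt_stringPotential {n : ℕ} {x : EuclideanSpace ℝ (Fin 3)}
    (hx : x ∈ Metric.closedBall (centre n) (1 / 4)) : 1 < stringPotential x := by
  obtain ⟨j, hj⟩ := isStringIndex_nth n
  refine lt_of_lt_of_le ?_ (ENNReal.le_tsum j)
  refine lt_of_lt_of_le ?_ (mul_le_mul_right (ofReal_harmonic_le_sum_inv_enorm hj hx) _)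
  rw [← ENNReal.ofReal_mul (by positivity), ENNReal.one_lt_ofReal]
  have h1 := log_add_one_le_harmonic (stringOffset j)
  have h2 : Real.log (stringOffset j : ℝ) ≤ Real.log ((stringOffset j + 1 : ℕ) : ℝ) := by
    have := stringOffset_pos j
    exact Real.log_le_log (by positivity) (by push_cast; linarith)
  have h3 : Real.log (stringOffset j : ℝ) = 2 ^ (j + 4) * Real.log 2 := by
    rw [stringOffset, Nat.cast_pow, Real.log_pow]; push_cast; rfl
  have h4 : (2 : ℝ) ^ (j + 4) * (1 / 2) < 2 ^ (j + 4) * Real.log 2 := by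
    gcongr
    exact lt_trans (by norm_num) Real.log_two_gt_d9
  have h5 := (h4.trans_eq h3.symm).trans_le (h2.trans h1)
  rw [div_mul_eq_mul_div, lt_div_iff₀ (by positivity)]
  linarith

theorem avoidable_centre : Avoidable.{u} centre fun _ => 1 / 4 := by
  intro Ω _ P W hW
  have := hW.isProbabilityMeasure
  set A := {ω | ∀ t : ℝ≥0, ∀ n : ℕ, W t ω ∉ Metric.closedBall (centre n) (1 / 4)}
  have hA : P Aᶜ < 1 := by
    refine lt_of_le_of_lt ((measure_mono ?_).trans (hW.measure_exists_one_lt_le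
      lowerSemicontinuous_stringPotential gaussianExcessive_stringPotential))
      stringPotential_zero_lt_one
    intro ω hω
    simp only [A, Set.mem_compl_iff, Set.mem_ofPred_eq, not_forall, not_not] at hω
    obtain ⟨t, n, h⟩ := hω
    exact ⟨t, one_lt_stringPotential h⟩
  -- Subadditivity suffices here, so measurability of `A` is not needed.
  by_contra h0
  have h1 : P Set.univ ≤ P A + P Aᶜ := by
    rw [← Set.union_compl_self A]; exact measure_union_le _ _
  rw [measure_univ, nonpos_iff_eq_zero.1 (not_lt.1 h0), zero_add] at h1
  exact h1.not_gt hA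

theorem mainTheorem5 :
    ∃ (c : ℕ → EuclideanSpace ℝ (Fin 3)) (r : ℕ → ℝ),
      IsBallConfiguration c r ∧
      Avoidable.{u} c r ∧
      Separated c ∧
      Tendsto (fun N : ℕ => ∑ n ∈ Finset.range N, r n / ‖c n‖) atTop atTop ∧
      (∀ n, r n = 1 / 4) ∧
      ∃ m k : ℕ → ℕ,
        (∀ j, 1 ≤ k j) ∧
        (∀ j, m j + 2 * k j < m (j + 1)) ∧
        Set.range c = ⋃ j, stringCentres (m j) (k j) := by
  refine ⟨centre, fun _ => 1 / 4, isBallConfiguration_centre, avoidable_centre, separated_centre,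
    tendsto_sum_radius_div_norm_centre, fun _ => rfl, stringOffset, stringOffset,
    stringOffset_pos, fun j => ?_, range_centre⟩
  have := four_mul_stringOffset_lt j
  omega
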